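/- Let $n$ be an even positive integer, let $q=2^n$, let $\mathbb{F}_q$ be the finite field with $q$ elements, and let $\alpha\in\mathbb{F}_q\setminus\{0\}$. Let $F:\mathbb{F}_q\to\mathbb{F}_q$, $F(x)=x^{q-2}$, be the inverse function, and let $F_{0,\alpha}$ be the permutation of $\mathbb{F}_q$ obtained by composing $F$ with the transposition $(0,\ \alpha^{q-2})$ applied after $F$; that is, $F_{0,\alpha}(0)=\alpha^{-1}$, $F_{0,\alpha}(\alpha)=0$ and $F_{0,\alpha}(c)=c^{-1}$ for all $c\in\mathbb{F}_q\setminus\{0,\alpha\}$. For a function $G:\mathbb{F}_q\to\mathbb{F}_q$ let $$VF_G=\{\{x,y,z,x+y+z\} : x,y,z\in\mathbb{F}_q \text{ pairwise distinct},\ G(x)+G(y)+G(z)+G(x+y+z)=0\}$$ be the set of vanishing flats with respect to $G$. Then $$|VF_{F_{0,\alpha}}|=|VF_F|=\tfrac{1}{3}(q-1).$$ -/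

import Mathlib

/-- The set of vanishing flats of `G`: all sets `{x, y, z, x + y + z}` with `x`, `y`, `z` pairwise
distinct and `G x + G y + G z + G (x + y + z) = 0`. -/
def vanishingFlats {K : Type*} [Field K] (G : K → K) : Set (Set K) :=
  {S | ∃ x y z : K, x ≠ y ∧ x ≠ z ∧ y ≠ z ∧
    G x + G y + G z + G (x + y + z) = 0 ∧ S = {x, y, z, x + y + z}}

/-- The inverse function `x ↦ x ^ (2 ^ n - 2)` on a field with `2 ^ n` elements. -/
def inverseFn (K : Type*) [Field K] (n : ℕ) : K → K :=
  fun x => x ^ (2 ^ n - 2)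

/-- The modification `F_{0, α}` of the inverse function `F`: first apply `F`, then the
transposition `(0, α ^ (2 ^ n - 2))`. Thus the values of `F` at `0` and at `α` are interchanged. -/
def modifiedInverse {K : Type*} [Field K] [DecidableEq K] (n : ℕ) (α : K) : K → K :=
  fun x => Equiv.swap (0 : K) (α ^ (2 ^ n - 2)) (inverseFn K n x)

/-! Vanishing flats through a fixed point `p` are counted by ordered pairs `(u, v)` of further
points, six pairs per flat (`card_flatPairs`). Evenness of `n` supplies `w` with `w ^ 2 + w + 1 =
0`. For inversion every flat contains 0, and the pairs at 0 are `(u, w * u)` and `(u, (w + 1) * u)`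
with `u ≠ 0`: `2(q - 1)` pairs, hence `(q - 1) / 3` flats. For the modified function, scaling
reduces to `α = 1`, i.e. to `swappedInv`. Away from 0 and 1 this is inversion, so every flat meets
`{0, 1}`. It is an involution exchanging 0 and 1, so equally many flats pass through each
(`card_flatPairs_of_involutive`), and only the subfield of order 4 contains both. The pairs at 0 are
6 from that subfield and `q - 4` on a rational cubic. Thus the total is `2(q + 2) / 6 - 1 = (q - 1)
/ 3`. -/

theorem inverseFn_eq_inv {K : Type*} [Field K] [Fintype K] {n : ℕ} (hn : Even n)
    (hK : Fintype.card K = 2 ^ n) (x : K) : inverseFn K n x = x⁻¹ := by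
  -- For `q = 2` the exponent would be 0 and the value at 0 would be 1 instead of 0.
  have hn2 : 2 ≤ n := by
    rcases hn with ⟨k, rfl⟩
    rcases Nat.eq_zero_or_pos k with rfl | hk
    · have := Fintype.one_lt_card (α := K)
      simp [hK] at this
    · omega
  have h4 : 2 ^ 2 ≤ 2 ^ n := Nat.pow_le_pow_right (by norm_num) hn2
  unfold inverseFn
  by_cases hx : x = 0
  · subst hx
    rw [zero_pow (by omega), inv_zero]
  · refine eq_inv_of_mul_eq_one_left ?_
    rw [← pow_succ, show 2 ^ n - 2 + 1 = 2 ^ n - 1 by omega, ← hK]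
    exact FiniteField.pow_card_sub_one_eq_one x hx

/-- Since `3 ∣ 4 ^ k - 1`, Cauchy's theorem gives a unit of order 3, a root of `(x - 1)(x ^ 2 + x +
1)` other than 1. -/
theorem exists_primitive_cube_root {K : Type*} [Field K] [Fintype K] {n : ℕ} (hn : Even n)
    (hK : Fintype.card K = 2 ^ n) : ∃ w : K, w ^ 2 + w + 1 = 0 := by
  classical
  have h3 : 3 ∣ Fintype.card Kˣ := by
    rw [Fintype.card_units, hK]
    obtain ⟨k, rfl⟩ := hn
    rw [← two_mul, pow_mul]
    simpa using Nat.sub_dvd_pow_sub_pow 4 1 k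
  have : Fact (Nat.Prime 3) := ⟨Nat.prime_three⟩
  obtain ⟨u, hu⟩ := exists_prime_orderOf_dvd_card 3 h3
  have h1 : (u : K) ≠ 1 := by
    intro h
    rw [Units.val_eq_one] at h
    simp [h] at hu
  have hu3 : (u : K) ^ 3 = 1 := by
    have := pow_orderOf_eq_one u
    rw [hu] at this
    rw [← Units.val_pow_eq_pow_val, this, Units.val_one]
  refine ⟨u, mul_left_cancel₀ (sub_ne_zero.2 h1) ?_⟩
  linear_combination hu3

/-- Rescaling the argument and the value of a function does not change the number of its
vanishing flats. -/
theorem ncard_vanishingFlats_of_scaling {K : Type*} [Field K] {G H : K → K} {c d : K}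
    (hc : c ≠ 0) (hd : d ≠ 0) (h : ∀ x, H (c * x) = d * G x) :
    (vanishingFlats H).ncard = (vanishingFlats G).ncard := by
  have himg : vanishingFlats H = (fun S => (fun x => c * x) '' S) '' vanishingFlats G := by
    ext S
    constructor
    · rintro ⟨x, y, z, hxy, hxz, hyz, hs, rfl⟩
      obtain ⟨x, rfl⟩ : ∃ x', x = c * x' := ⟨c⁻¹ * x, by field_simp⟩
      obtain ⟨y, rfl⟩ : ∃ x', y = c * x' := ⟨c⁻¹ * y, by field_simp⟩
      obtain ⟨z, rfl⟩ : ∃ x', z = c * x' := ⟨c⁻¹ * z, by field_simp⟩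
      refine ⟨{x, y, z, x + y + z}, ⟨x, y, z, ?_, ?_, ?_, ?_, rfl⟩, ?_⟩
      · rintro rfl; exact hxy rfl
      · rintro rfl; exact hxz rfl
      · rintro rfl; exact hyz rfl
      · rw [← mul_add, ← mul_add, h, h, h, h] at hs
        exact mul_left_cancel₀ hd (by linear_combination hs)
      · simp [Set.image_insert_eq, mul_add]
    · rintro ⟨_, ⟨x, y, z, hxy, hxz, hyz, hs, rfl⟩, rfl⟩
      refine ⟨c * x, c * y, c * z, by simp [hc, hxy], by simp [hc, hxz], by simp [hc, hyz], ?_, ?_⟩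
      · rw [← mul_add, ← mul_add, h, h, h, h]
        linear_combination d * hs
      · simp [Set.image_insert_eq, mul_add]
  rw [himg]
  exact Set.ncard_image_of_injective _ (Set.image_injective.2 (mul_right_injective₀ hc))

/-- The ordered pairs `(u, v)` which complete `p` to a vanishing flat of `G`. -/
def flatPairs {K : Type*} [Field K] [Fintype K] [DecidableEq K] (G : K → K) (p : K) :
    Finset (K × K) :=
  {a | a.1 ≠ p ∧ a.2 ≠ p ∧ a.1 ≠ a.2 ∧ G p + G a.1 + G a.2 + G (p + a.1 + a.2) = 0}

/-! ### Flats through a point in characteristic two -/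

section CharTwo

variable {K : Type*} [Field K] [CharP K 2]

theorem eq_or_eq_of_sq_add_self_add_one {w x : K} (hw : w ^ 2 + w + 1 = 0)
    (hx : x ^ 2 + x + 1 = 0) : x = w ∨ x = w + 1 := by
  have h2 : (2 : K) = 0 := CharTwo.two_eq_zero
  have : (x - w) * (x - (w + 1)) = 0 := by
    linear_combination hx + hw - (x * w + x + 1) * h2
  rcases mul_eq_zero.1 this with h | h
  · exact Or.inl (sub_eq_zero.1 h)
  · exact Or.inr (sub_eq_zero.1 h)

variable [DecidableEq K]

/-- The four points sum to zero, so `p` and any two of the others determine the last. -/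
theorem insert_eq_of_mem_flat {p u v x y : K} (hup : u ≠ p) (hvp : v ≠ p) (huv : u ≠ v)
    (hx : x ∈ ({u, v, p + u + v} : Finset K)) (hy : y ∈ ({u, v, p + u + v} : Finset K))
    (hxy : x ≠ y) : ({p, x, y, p + x + y} : Finset K) = {p, u, v, p + u + v} := by
  have h2 : (2 : K) = 0 := CharTwo.two_eq_zero
  have e1 : p + u + (p + u + v) = v := by linear_combination (p + u) * h2
  have e2 : p + v + (p + u + v) = u := by linear_combination (p + v) * h2
  have e3 : p + (p + u + v) + u = v := by linear_combination (p + u) * h2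
  have e4 : p + (p + u + v) + v = u := by linear_combination (p + v) * h2
  have e5 : p + v + u = p + u + v := by ring
  simp only [Finset.mem_insert, Finset.mem_singleton] at hx hy
  rcases hx with rfl | rfl | rfl <;> rcases hy with rfl | rfl | rfl <;>
    first
    | exact absurd rfl hxy
    | rfl
    | (simp only [e1, e2, e3, e4, e5]
       ext a
       simp only [Finset.mem_insert, Finset.mem_singleton]
       tauto)

variable [Fintype K]

/-- The pairs giving one flat are the ordered pairs of distinct points among its three points other
than `p`, which is the source of the factor 6. -/
theorem filter_flatPairs_eq_offDiag {G : K → K} {p u v : K} (h : (u, v) ∈ flatPairs G p) :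
    {a ∈ flatPairs G p | ({p, a.1, a.2, p + a.1 + a.2} : Finset K) = {p, u, v, p + u + v}} =
      ({u, v, p + u + v} : Finset K).offDiag := by
  have h2 : (2 : K) = 0 := CharTwo.two_eq_zero
  simp only [flatPairs, Finset.mem_filter_univ] at h
  obtain ⟨hup, hvp, huv, hs⟩ := h
  have hw : p + u + v ≠ p := fun h => huv (by linear_combination h - v * h2)
  ext ⟨x, y⟩
  simp only [flatPairs, Finset.mem_filter, Finset.mem_univ, true_and, Finset.mem_offDiag]
  constructor
  · rintro ⟨⟨hx, hy, hxy, -⟩, heq⟩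
    have hx' : x ∈ ({p, u, v, p + u + v} : Finset K) := heq ▸ by simp
    have hy' : y ∈ ({p, u, v, p + u + v} : Finset K) := heq ▸ by simp
    exact ⟨(Finset.mem_insert.1 hx').resolve_left hx, (Finset.mem_insert.1 hy').resolve_left hy,
      hxy⟩
  · rintro ⟨hx, hy, hxy⟩
    refine ⟨⟨?_, ?_, hxy, ?_⟩, insert_eq_of_mem_flat hup hvp huv hx hy hxy⟩
    · rintro rfl
      simp only [Finset.mem_insert, Finset.mem_singleton] at hx
      rcases hx with h | h | h
      exacts [hup h.symm, hvp h.symm, hw h.symm]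
    · rintro rfl
      simp only [Finset.mem_insert, Finset.mem_singleton] at hy
      rcases hy with h | h | h
      exacts [hup h.symm, hvp h.symm, hw h.symm]
    · have e1 : p + u + (p + u + v) = v := by linear_combination (p + u) * h2
      have e2 : p + v + (p + u + v) = u := by linear_combination (p + v) * h2
      have e3 : p + (p + u + v) + u = v := by linear_combination (p + u) * h2
      have e4 : p + (p + u + v) + v = u := by linear_combination (p + v) * h2
      have e5 : p + v + u = p + u + v := by ring
      simp only [Finset.mem_insert, Finset.mem_singleton] at hx hy
      rcases hx with rfl | rfl | rfl <;> rcases hy with rfl | rfl | rfl <;>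
        first
        | exact absurd rfl hxy
        | exact hs
        | (simp only [e1, e2, e3, e4, e5]; linear_combination hs)

theorem card_flatPairs_eq_six_mul_card_image (G : K → K) (p : K) :
    (flatPairs G p).card =
      6 * ((flatPairs G p).image fun a => ({p, a.1, a.2, p + a.1 + a.2} : Finset K)).card := by
  have h2 : (2 : K) = 0 := CharTwo.two_eq_zero
  rw [Finset.card_eq_sum_card_image (fun a => ({p, a.1, a.2, p + a.1 + a.2} : Finset K)),
    Finset.sum_const_nat (m := 6), mul_comm]
  intro S hS
  obtain ⟨⟨u, v⟩, h, rfl⟩ := Finset.mem_image.1 hS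
  rw [filter_flatPairs_eq_offDiag h]
  simp only [flatPairs, Finset.mem_filter_univ] at h
  obtain ⟨hup, hvp, huv, -⟩ := h
  have h3 : ({u, v, p + u + v} : Finset K).card = 3 := by
    refine Finset.card_eq_three.2 ⟨u, v, _, huv, fun h => hvp ?_, fun h => hup ?_, rfl⟩
    · linear_combination -h - p * h2
    · linear_combination -h - p * h2
  rw [Finset.offDiag_card, h3]

omit [Fintype K] [DecidableEq K] in
theorem exists_pair_of_mem_vanishingFlats {G : K → K} {S : Set K} {p : K}
    (hS : S ∈ vanishingFlats G) (hp : p ∈ S) :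
    ∃ u v, u ≠ p ∧ v ≠ p ∧ u ≠ v ∧ G p + G u + G v + G (p + u + v) = 0 ∧
      S = {p, u, v, p + u + v} := by
  have h2 : (2 : K) = 0 := CharTwo.two_eq_zero
  obtain ⟨x, y, z, hxy, hxz, hyz, hs, rfl⟩ := hS
  simp only [Set.mem_insert_iff, Set.mem_singleton_iff] at hp
  rcases hp with rfl | rfl | rfl | rfl
  · exact ⟨y, z, hxy.symm, hxz.symm, hyz, hs, rfl⟩
  · have e : p + x + z = x + p + z := by ring
    refine ⟨x, z, hxy, hyz.symm, hxz, ?_, ?_⟩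
    · rw [e]; linear_combination hs
    · rw [e]; ext a; simp only [Set.mem_insert_iff, Set.mem_singleton_iff]; tauto
  · have e : p + x + y = x + y + p := by ring
    refine ⟨x, y, hxz, hyz, hxy, ?_, ?_⟩
    · rw [e]; linear_combination hs
    · rw [e]; ext a; simp only [Set.mem_insert_iff, Set.mem_singleton_iff]; tauto
  · have e : x + y + z + x + y = z := by linear_combination (x + y) * h2
    refine ⟨x, y, fun h => hyz ?_, fun h => hxz ?_, hxy, ?_, ?_⟩
    · linear_combination -h - z * h2
    · linear_combination -h - z * h2
    · rw [e]; linear_combination hs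
    · rw [e]; ext a; simp only [Set.mem_insert_iff, Set.mem_singleton_iff]; tauto

/-- The pairs completing `p` to a vanishing flat are six times as many as the vanishing flats
through `p`. -/
theorem card_flatPairs (G : K → K) (p : K) :
    (flatPairs G p).card = 6 * {S ∈ vanishingFlats G | p ∈ S}.ncard := by
  have : {S ∈ vanishingFlats G | p ∈ S} = (fun s : Finset K => (s : Set K)) ''
      ((flatPairs G p).image fun a => ({p, a.1, a.2, p + a.1 + a.2} : Finset K) :
        Finset (Finset K)) := by
    ext S
    simp only [Set.mem_ofPred_eq, Set.mem_image, Finset.mem_coe, Finset.mem_image, Prod.exists,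
      flatPairs, Finset.mem_filter_univ]
    constructor
    · rintro ⟨hS, hp⟩
      obtain ⟨u, v, hu, hv, huv, hs, rfl⟩ := exists_pair_of_mem_vanishingFlats hS hp
      exact ⟨_, ⟨u, v, ⟨hu, hv, huv, hs⟩, rfl⟩, by simp⟩
    · rintro ⟨_, ⟨u, v, ⟨hu, hv, huv, hs⟩, rfl⟩, rfl⟩
      exact ⟨⟨p, u, v, hu.symm, hv.symm, huv, hs, by simp⟩, by simp⟩
  rw [this, Set.ncard_image_of_injective _ Finset.coe_injective, Set.ncard_coe_finset,
    card_flatPairs_eq_six_mul_card_image]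

/-! ### Sums of inverses -/

omit [Fintype K] [DecidableEq K] in
theorem inv_add_inv_add_inv_add_inv_ne_zero {x y z : K} (hx : x ≠ 0) (hy : y ≠ 0) (hz : z ≠ 0)
    (hw : x + y + z ≠ 0) (hxy : x ≠ y) (hxz : x ≠ z) (hyz : y ≠ z) :
    x⁻¹ + y⁻¹ + z⁻¹ + (x + y + z)⁻¹ ≠ 0 := by
  have h2 : (2 : K) = 0 := CharTwo.two_eq_zero
  intro h
  field_simp at h
  -- In characteristic two this product is the numerator of the sum of the four inverses.
  have : (x - y) * ((x - z) * (y - z)) = 0 := by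
    linear_combination h - (x ^ 2 * z + x * y ^ 2 + y * z ^ 2 + 2 * x * y * z) * h2
  simp [sub_eq_zero, hxy, hxz, hyz] at this

-- Clearing denominators leaves `u ^ 2 + u * v + v ^ 2`, which splits as `(v - w * u) * (v - (w + 1)
-- * u)`.
omit [Fintype K] [DecidableEq K] in
theorem inv_add_inv_add_inv_eq_zero_iff {w u v : K} (hw : w ^ 2 + w + 1 = 0)
    (hu : u ≠ 0) (hv : v ≠ 0) (huv : u ≠ v) :
    u⁻¹ + v⁻¹ + (u + v)⁻¹ = 0 ↔ v = w * u ∨ v = (w + 1) * u := by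
  have h2 : (2 : K) = 0 := CharTwo.two_eq_zero
  have hs : u + v ≠ 0 := fun h => huv (by linear_combination h - v * h2)
  constructor
  · intro h
    field_simp at h
    have : (v - w * u) * (v - (w + 1) * u) = 0 := by
      linear_combination h + u ^ 2 * hw - (u * v * (w + 2) + u ^ 2) * h2
    rcases mul_eq_zero.1 this with h | h
    · exact Or.inl (sub_eq_zero.1 h)
    · exact Or.inr (sub_eq_zero.1 h)
  · have hw0 : w ≠ 0 := by rintro rfl; simp at hw
    have hw1 : w + 1 ≠ 0 := fun h => one_ne_zero (α := K) (by linear_combination hw - w * h)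
    have e : w * (w + 1) + (w + 1) + w = 0 := by linear_combination hw + w * h2
    have e1 : u + w * u = (w + 1) * u := by ring
    have e2 : u + (w + 1) * u = w * u := by linear_combination u * h2
    rintro (rfl | rfl)
    · rw [e1]
      field_simp
      linear_combination e
    · rw [e2]
      field_simp
      linear_combination e

end CharTwo

/-! ### Flats of the inverse function -/

section CharTwo

variable {K : Type*} [Field K] [CharP K 2] [DecidableEq K]

theorem card_flatPairs_inv [Fintype K] {w : K} (hw : w ^ 2 + w + 1 = 0) :
    (flatPairs (fun x : K => x⁻¹) 0).card = 2 * (Fintype.card K - 1) := by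
  have h2 : (2 : K) = 0 := CharTwo.two_eq_zero
  have hw0 : w ≠ 0 := by rintro rfl; simp at hw
  have hw1 : w ≠ 1 := by
    rintro rfl
    exact one_ne_zero (α := K) (by linear_combination hw - h2)
  have hw2 : w + 1 ≠ 0 := fun h => one_ne_zero (α := K) (by linear_combination hw - w * h)
  have himg : flatPairs (fun x : K => x⁻¹) 0 =
      ((Finset.univ.erase (0 : K)) ×ˢ ({w, w + 1} : Finset K)).image
        fun a => (a.1, a.2 * a.1) := by
    ext ⟨u, v⟩
    simp only [flatPairs, Finset.mem_filter_univ, Finset.mem_image, Finset.mem_product,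
      Finset.mem_erase, Finset.mem_univ, and_true, Finset.mem_insert, Finset.mem_singleton,
      Prod.exists, Prod.mk.injEq, inv_zero, zero_add]
    constructor
    · rintro ⟨hu, hv, huv, hs⟩
      rcases (inv_add_inv_add_inv_eq_zero_iff hw hu hv huv).1 hs with h | h
      · exact ⟨u, w, ⟨hu, Or.inl rfl⟩, rfl, h.symm⟩
      · exact ⟨u, w + 1, ⟨hu, Or.inr rfl⟩, rfl, h.symm⟩
    · rintro ⟨u, t, ⟨hu, ht⟩, rfl, rfl⟩
      have ht0 : t ≠ 0 := by rcases ht with rfl | rfl <;> assumption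
      have ht1 : t ≠ 1 := by
        rcases ht with rfl | rfl
        · exact hw1
        · simpa using hw0
      have hut : u ≠ t * u := fun h => ht1 (mul_right_cancel₀ hu (by rw [one_mul, ← h]))
      refine ⟨hu, mul_ne_zero ht0 hu, hut,
        (inv_add_inv_add_inv_eq_zero_iff hw hu (mul_ne_zero ht0 hu) hut).2 ?_⟩
      rcases ht with rfl | rfl
      · exact Or.inl rfl
      · exact Or.inr rfl
  rw [himg, Finset.card_image_of_injOn, Finset.card_product, Finset.card_erase_of_mem
    (Finset.mem_univ _), Finset.card_univ, Finset.card_pair (by simp), mul_comm]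
  rintro ⟨u, s⟩ hu ⟨v, t⟩ - h
  simp only [Finset.coe_product, Set.mem_prod, Finset.mem_coe, Finset.mem_erase] at hu
  simp only [Prod.mk.injEq] at h ⊢
  obtain ⟨rfl, h⟩ := h
  exact ⟨rfl, mul_right_cancel₀ hu.1.1 h⟩

omit [DecidableEq K] in
theorem zero_mem_of_mem_vanishingFlats_inv {S : Set K}
    (hS : S ∈ vanishingFlats (fun x : K => x⁻¹)) : (0 : K) ∈ S := by
  obtain ⟨x, y, z, hxy, hxz, hyz, hs, rfl⟩ := hS
  by_contra h
  simp only [Set.mem_insert_iff, Set.mem_singleton_iff, not_or] at h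
  exact inv_add_inv_add_inv_add_inv_ne_zero (Ne.symm h.1) (Ne.symm h.2.1) (Ne.symm h.2.2.1)
    (Ne.symm h.2.2.2) hxy hxz hyz hs

theorem three_mul_ncard_vanishingFlats_inv [Fintype K] {w : K} (hw : w ^ 2 + w + 1 = 0) :
    3 * (vanishingFlats (fun x : K => x⁻¹)).ncard = Fintype.card K - 1 := by
  have h := card_flatPairs (fun x : K => x⁻¹) 0
  have hsep : {S ∈ vanishingFlats (fun x : K => x⁻¹) | (0 : K) ∈ S} = vanishingFlats _ :=
    Set.sep_eq_self_iff_mem_true.2 fun S hS => zero_mem_of_mem_vanishingFlats_inv hS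
  rw [card_flatPairs_inv hw, hsep] at h
  omega

/-! ### Flats of the swapped inverse function -/

/-- The inverse function with its values at `0` and `1` interchanged. -/
def swappedInv (x : K) : K := Equiv.swap 0 1 x⁻¹

omit [CharP K 2] in
theorem swappedInv_zero : swappedInv (0 : K) = 1 := by simp [swappedInv]

omit [CharP K 2] in
theorem swappedInv_one : swappedInv (1 : K) = 0 := by simp [swappedInv]

omit [CharP K 2] in
theorem swappedInv_of_ne {x : K} (h0 : x ≠ 0) (h1 : x ≠ 1) : swappedInv x = x⁻¹ :=
  Equiv.swap_apply_of_ne_of_ne (inv_ne_zero h0) (by simpa using h1)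

omit [CharP K 2] in
theorem swappedInv_involutive : Function.Involutive (swappedInv : K → K) := by
  intro x
  by_cases h0 : x = 0
  · rw [h0, swappedInv_zero, swappedInv_one]
  by_cases h1 : x = 1
  · rw [h1, swappedInv_one, swappedInv_zero]
  rw [swappedInv_of_ne h0 h1, swappedInv_of_ne (inv_ne_zero h0) (by simpa using h1), inv_inv]

/-- A flat vanishes when its points and their values both sum to zero; an involution exchanges these
two conditions. -/
theorem card_flatPairs_of_involutive [Fintype K] {G : K → K} (hG : G.Involutive) (p : K) :
    (flatPairs G p).card = (flatPairs G (G p)).card := by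
  have key : ∀ p, ∀ a ∈ flatPairs G p, (G a.1, G a.2) ∈ flatPairs G (G p) := by
    have h2 : (2 : K) = 0 := CharTwo.two_eq_zero
    rintro p ⟨u, v⟩ h
    simp only [flatPairs, Finset.mem_filter_univ, ne_eq, hG.injective.eq_iff] at h ⊢
    refine ⟨h.1, h.2.1, h.2.2.1, ?_⟩
    rw [show G p + G u + G v = G (p + u + v) by
      linear_combination h.2.2.2 - G (p + u + v) * h2, hG, hG, hG, hG]
    linear_combination (p + u + v) * h2
  refine Finset.card_bij' (fun a _ => (G a.1, G a.2)) (fun a _ => (G a.1, G a.2)) (key p) ?_ ?_ ?_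
  · intro a ha
    simpa [hG p] using key (G p) a ha
  · intro a _
    simp [hG _]
  · intro a _
    simp [hG _]

theorem eq_one_of_mem_offDiag {w u v : K} (h : (u, v) ∈ ({1, w, w + 1} : Finset K).offDiag) :
    u = 1 ∨ v = 1 ∨ u + v = 1 := by
  have h2 : (2 : K) = 0 := CharTwo.two_eq_zero
  simp only [Finset.mem_offDiag, Finset.mem_insert, Finset.mem_singleton] at h
  obtain ⟨rfl | hu, rfl | hv, h⟩ := h
  · exact Or.inl rfl
  · exact Or.inl rfl
  · exact Or.inr (Or.inl rfl)
  · refine Or.inr (Or.inr ?_)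
    rcases hu with rfl | rfl <;> rcases hv with rfl | rfl
    · exact absurd rfl h
    · linear_combination u * h2
    · linear_combination v * h2
    · exact absurd rfl h

/-- If one of `u`, `v`, `u + v` is 1, its value is 0 and the remaining equation forces the subfield
of order 4. Otherwise all three values are inverses, and clearing denominators in `1 + u⁻¹ + v⁻¹ +
(u + v)⁻¹ = 0` gives the cubic. -/
theorem mem_flatPairs_swappedInv_zero_iff [Fintype K] {w u v : K} (hw : w ^ 2 + w + 1 = 0) :
    (u, v) ∈ flatPairs swappedInv 0 ↔
      (u, v) ∈ ({1, w, w + 1} : Finset K).offDiag ∨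
      u ≠ 0 ∧ v ≠ 0 ∧ u ≠ v ∧ u ≠ 1 ∧ v ≠ 1 ∧ u + v ≠ 1 ∧
        u * v * (u + v) + u ^ 2 + u * v + v ^ 2 = 0 := by
  have h2 : (2 : K) = 0 := CharTwo.two_eq_zero
  have hw0 : w ≠ 0 := by rintro rfl; simp at hw
  have hw1 : w ≠ 1 := by
    rintro rfl
    exact one_ne_zero (α := K) (by linear_combination hw - h2)
  have hw2 : w + 1 ≠ 0 := fun h => one_ne_zero (α := K) (by linear_combination hw - w * h)
  have hw3 : w + 1 ≠ 1 := by simpa using hw0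
  simp only [flatPairs, Finset.mem_filter_univ, swappedInv_zero, zero_add, Finset.mem_offDiag,
    Finset.mem_insert, Finset.mem_singleton]
  by_cases hu0 : u = 0
  · simp [hu0, hw0.symm, hw2.symm]
  by_cases hv0 : v = 0
  · simp [hv0, hw0.symm, hw2.symm]
  by_cases huv : u = v
  · simp [huv]
  have hs0 : u + v ≠ 0 := fun h => huv (by linear_combination h - v * h2)
  have key : ∀ x : K, x ≠ 0 → x ≠ 1 → (1 + x⁻¹ + (1 + x)⁻¹ = 0 ↔ x = w ∨ x = w + 1) := by
    intro x hx0 hx1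
    simpa using inv_add_inv_add_inv_eq_zero_iff hw one_ne_zero hx0 hx1.symm
  have hadd : ∀ x : K, x ≠ 0 → x ≠ 1 → 1 + x ≠ 0 ∧ 1 + x ≠ 1 := fun x hx0 hx1 =>
    ⟨fun h => hx1 (by linear_combination h - h2), by simpa using hx0⟩
  by_cases hu1 : u = 1
  · subst hu1
    have hv1 : v ≠ 1 := Ne.symm huv
    obtain ⟨h0, h1⟩ := hadd v hv0 hv1
    rw [swappedInv_one, swappedInv_of_ne hv0 hv1, swappedInv_of_ne h0 h1, add_zero, key v hv0 hv1]
    simp [hv0, hv1, hv1.symm]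
  by_cases hv1 : v = 1
  · subst hv1
    obtain ⟨h0, h1⟩ := hadd u hu0 hu1
    rw [add_comm u 1, swappedInv_one, swappedInv_of_ne hu0 hu1, swappedInv_of_ne h0 h1, add_zero,
      key u hu0 hu1]
    simp [hu0, hu1]
  by_cases hs1 : u + v = 1
  · obtain rfl : v = 1 + u := by linear_combination hs1 - u * h2
    have e : (1 + u = w ∨ 1 + u = w + 1) ↔ u = w ∨ u = w + 1 := by
      constructor
      · rintro (h | h)
        · exact Or.inr (by linear_combination h - h2)
        · exact Or.inl (by linear_combination h)
      · rintro (rfl | rfl)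
        · exact Or.inr (add_comm _ _)
        · exact Or.inl (by linear_combination h2)
    rw [hs1, swappedInv_one, swappedInv_of_ne hu0 hu1, swappedInv_of_ne hv0 hv1, add_zero,
      key u hu0 hu1]
    simp only [hu1, hv1, e, false_or]
    refine ⟨fun h => Or.inl ⟨h.2.2.2, h.2.2.2, h.2.2.1⟩, fun h => ⟨hu0, hv0, huv, ?_⟩⟩
    rcases h with h | h
    · exact h.1
    · exact absurd rfl h.2.2.2.2.2.1
  rw [swappedInv_of_ne hu0 hu1, swappedInv_of_ne hv0 hv1, swappedInv_of_ne hs0 hs1]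
  have hpoly : 1 + u⁻¹ + v⁻¹ + (u + v)⁻¹ = 0 ↔ u * v * (u + v) + u ^ 2 + u * v + v ^ 2 = 0 := by
    field_simp
    constructor <;> intro h
    · linear_combination h - u * v * h2
    · linear_combination h + u * v * h2
  rw [hpoly]
  refine ⟨fun h => Or.inr ⟨h.1, h.2.1, h.2.2.1, hu1, hv1, hs1, h.2.2.2⟩, fun h => ?_⟩
  rcases h with h | h
  · rcases eq_one_of_mem_offDiag (w := w) (by simpa using h) with h | h | h <;> contradiction
  · exact ⟨h.1, h.2.1, h.2.2.1, h.2.2.2.2.2.2⟩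

/-- The cubic is singular at the origin, so the lines `v = t * u` parametrize it. The slopes 0 and 1
are excluded by `v ≠ 0` and `u ≠ v`, and `w`, `w + 1` make `u` vanish, leaving `q - 4` points
besides the 6 pairs from the subfield. -/
theorem card_flatPairs_swappedInv_zero [Fintype K] {w : K} (hw : w ^ 2 + w + 1 = 0) :
    (flatPairs (swappedInv : K → K) 0).card = Fintype.card K + 2 := by
  have h2 : (2 : K) = 0 := CharTwo.two_eq_zero
  have hw0 : w ≠ 0 := by rintro rfl; simp at hw
  have hw1 : w ≠ 1 := by
    rintro rfl
    exact one_ne_zero (α := K) (by linear_combination hw - h2)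
  have hw2 : w + 1 ≠ 0 := fun h => one_ne_zero (α := K) (by linear_combination hw - w * h)
  have hw3 : w + 1 ≠ 1 := by simpa using hw0
  have hww : w ≠ w + 1 := by simp
  let A : Finset (K × K) := ({1, w, w + 1} : Finset K).offDiag
  let T : Finset K := Finset.univ \ {0, 1, w, w + 1}
  let f : K → K × K := fun t =>
    ((t ^ 2 + t + 1) / (t * (t + 1)), t * ((t ^ 2 + t + 1) / (t * (t + 1))))
  have hT : ∀ t ∈ T, t ≠ 0 ∧ t ≠ 1 ∧ t + 1 ≠ 0 ∧ t ^ 2 + t + 1 ≠ 0 := by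
    intro t ht
    simp only [T, Finset.mem_sdiff, Finset.mem_univ, true_and, Finset.mem_insert,
      Finset.mem_singleton, not_or] at ht
    refine ⟨ht.1, ht.2.1, fun h => ht.2.1 (by linear_combination h - h2), fun h => ?_⟩
    exact (eq_or_eq_of_sq_add_self_add_one hw h).elim ht.2.2.1 ht.2.2.2
  have hmem : ∀ u v : K, (u, v) ∈ T.image f ↔ u ≠ 0 ∧ v ≠ 0 ∧ u ≠ v ∧ u ≠ 1 ∧ v ≠ 1 ∧
      u + v ≠ 1 ∧ u * v * (u + v) + u ^ 2 + u * v + v ^ 2 = 0 := by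
    intro u v
    rw [Finset.mem_image]
    constructor
    · rintro ⟨t, ht, h⟩
      obtain ⟨h0, h1, h10, hq⟩ := hT t ht
      simp only [f, Prod.mk.injEq] at h
      obtain ⟨hu, hv⟩ := h
      rw [hu] at hv
      subst hv
      have hu0 : u ≠ 0 := by
        rw [← hu]
        exact div_ne_zero hq (mul_ne_zero h0 h10)
      rw [div_eq_iff (mul_ne_zero h0 h10)] at hu
      -- On the curve, `u = 1`, `v = 1` and `u + v = 1` would force `1 = 0`, `t ^ 2 = 0` and `(t +
      -- 1) ^ 2 = 0` respectively.
      refine ⟨hu0, mul_ne_zero h0 hu0, fun h => h1 ?_, fun h => one_ne_zero (α := K) ?_,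
        fun h => h0 ?_, fun h => h10 ?_, ?_⟩
      · exact mul_right_cancel₀ hu0 (by rw [one_mul, ← h])
      · linear_combination hu + t * (t + 1) * h
      · exact pow_eq_zero_iff (two_ne_zero) |>.1 (by linear_combination hu + (t + 1) * h)
      · exact pow_eq_zero_iff (two_ne_zero) |>.1 (by linear_combination hu + t * h + t * h2)
      · linear_combination u ^ 2 * (u * t * (t + 1) * h2 + hu)
    · rintro ⟨hu, hv, huv, hu1, hv1, hs1, h⟩
      obtain ⟨t, rfl⟩ : ∃ t, v = t * u := ⟨v / u, by field_simp⟩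
      have ht0 : t ≠ 0 := by rintro rfl; simp at hv
      have ht1 : t ≠ 1 := by rintro rfl; simp at huv
      have ht10 : t + 1 ≠ 0 := fun h => ht1 (by linear_combination h - h2)
      have hp : u * (t * (t + 1)) + (t ^ 2 + t + 1) = 0 := by
        refine mul_left_cancel₀ (pow_ne_zero 2 hu) ?_
        linear_combination h
      have hq : t ^ 2 + t + 1 ≠ 0 := by
        intro hq
        rw [hq, add_zero] at hp
        simp [hu, ht0, ht10] at hp
      have hfu : (t ^ 2 + t + 1) / (t * (t + 1)) = u := by
        rw [div_eq_iff (mul_ne_zero ht0 ht10)]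
        linear_combination hp - u * (t * (t + 1)) * h2
      refine ⟨t, ?_, by simp only [f, hfu]⟩
      simp only [T, Finset.mem_sdiff, Finset.mem_univ, true_and, Finset.mem_insert,
        Finset.mem_singleton, not_or]
      refine ⟨ht0, ht1, ?_, ?_⟩
      · rintro rfl
        exact hq hw
      · rintro rfl
        exact hq (by linear_combination hw + (w + 1) * h2)
  have hunion : flatPairs (swappedInv : K → K) 0 = A ∪ T.image f := by
    ext ⟨u, v⟩
    rw [mem_flatPairs_swappedInv_zero_iff hw, Finset.mem_union, hmem]
  have hdisj : Disjoint A (T.image f) := by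
    rw [Finset.disjoint_left]
    rintro ⟨u, v⟩ hA hB
    obtain ⟨-, -, -, hu1, hv1, hs1, -⟩ := (hmem u v).1 hB
    rcases eq_one_of_mem_offDiag hA with h | h | h <;> contradiction
  have hinj : Set.InjOn f T := by
    intro s hs t ht h
    obtain ⟨hs0, -, hs10, hsq⟩ := hT s hs
    simp only [f, Prod.mk.injEq] at h
    obtain ⟨hu, hv⟩ := h
    rw [← hu] at hv
    exact mul_right_cancel₀ (div_ne_zero hsq (mul_ne_zero hs0 hs10)) hv
  have hA : A.card = 6 := by
    rw [Finset.offDiag_card, Finset.card_eq_three.2 ⟨1, w, w + 1, hw1.symm, hw3.symm, hww, rfl⟩]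
  have hTc : T.card + 4 = Fintype.card K := by
    have h4 : ({0, 1, w, w + 1} : Finset K).card = 4 := by
      rw [Finset.card_insert_of_notMem (by simp [hw0.symm, hw2.symm]),
        Finset.card_eq_three.2 ⟨1, w, w + 1, hw1.symm, hw3.symm, hww, rfl⟩]
    rw [← h4, Finset.card_sdiff_add_card_eq_card (Finset.subset_univ _), Finset.card_univ]
  rw [hunion, Finset.card_union_of_disjoint hdisj, Finset.card_image_of_injOn hinj, hA]
  omega

/-- A flat through 0 and 1 has 1 among `u`, `v`, `u + v`, which rules out the cubic case. -/
theorem sep_zero_inter_sep_one_swappedInv [Fintype K] {w : K} (hw : w ^ 2 + w + 1 = 0) :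
    {S ∈ vanishingFlats (swappedInv : K → K) | (0 : K) ∈ S} ∩
      {S ∈ vanishingFlats (swappedInv : K → K) | (1 : K) ∈ S} = {{0, 1, w, w + 1}} := by
  have h2 : (2 : K) = 0 := CharTwo.two_eq_zero
  have hw0 : w ≠ 0 := by rintro rfl; simp at hw
  have hw1 : w ≠ 1 := by
    rintro rfl
    exact one_ne_zero (α := K) (by linear_combination hw - h2)
  ext S
  simp only [Set.mem_inter_iff, Set.mem_ofPred_eq, Set.mem_singleton_iff]
  constructor
  · rintro ⟨⟨hS, h0⟩, -, h1⟩
    obtain ⟨u, v, hu, hv, huv, hs, rfl⟩ := exists_pair_of_mem_vanishingFlats hS h0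
    have hm : (u, v) ∈ flatPairs swappedInv (0 : K) := by
      simpa [flatPairs] using ⟨hu, hv, huv, by simpa using hs⟩
    simp only [Set.mem_insert_iff, Set.mem_singleton_iff, one_ne_zero, false_or, zero_add] at h1
    rcases (mem_flatPairs_swappedInv_zero_iff hw).1 hm with h | h
    · have e : ({1, w, w + 1} : Finset K) = {1, w, 0 + 1 + w} := by rw [zero_add, add_comm 1 w]
      rw [e, Finset.mem_offDiag] at h
      have := congrArg (fun s : Finset K => (s : Set K))
        (insert_eq_of_mem_flat one_ne_zero hw0 hw1.symm h.1 h.2.1 h.2.2)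
      simpa [add_comm 1 w] using this
    · rcases h1 with h1 | h1 | h1
      exacts [absurd h1.symm h.2.2.2.1, absurd h1.symm h.2.2.2.2.1, absurd h1.symm h.2.2.2.2.2.1]
  · rintro rfl
    have hm : (1, w) ∈ flatPairs swappedInv (0 : K) :=
      (mem_flatPairs_swappedInv_zero_iff hw).2 (Or.inl (by simp [hw1.symm]))
    simp only [flatPairs, Finset.mem_filter_univ] at hm
    obtain ⟨h1, h0, h01, hs⟩ := hm
    have hmem : ({0, 1, w, w + 1} : Set K) ∈ vanishingFlats swappedInv :=
      ⟨0, 1, w, h1.symm, h0.symm, h01, hs, by rw [zero_add, add_comm 1 w]⟩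
    exact ⟨⟨hmem, by simp⟩, hmem, by simp⟩

theorem sep_zero_union_sep_one_swappedInv :
    {S ∈ vanishingFlats (swappedInv : K → K) | (0 : K) ∈ S} ∪
      {S ∈ vanishingFlats (swappedInv : K → K) | (1 : K) ∈ S} = vanishingFlats swappedInv := by
  refine Set.Subset.antisymm (Set.union_subset (Set.sep_subset _ _) (Set.sep_subset _ _)) ?_
  intro S hS
  by_contra h
  simp only [Set.mem_union, Set.mem_ofPred_eq, hS, true_and, not_or] at h
  obtain ⟨x, y, z, hxy, hxz, hyz, hs, rfl⟩ := hS
  simp only [Set.mem_insert_iff, Set.mem_singleton_iff, not_or] at h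
  obtain ⟨⟨hx0, hy0, hz0, hs0⟩, hx1, hy1, hz1, hs1⟩ := h
  rw [swappedInv_of_ne (Ne.symm hx0) (Ne.symm hx1), swappedInv_of_ne (Ne.symm hy0) (Ne.symm hy1),
    swappedInv_of_ne (Ne.symm hz0) (Ne.symm hz1), swappedInv_of_ne (Ne.symm hs0) (Ne.symm hs1)] at hs
  exact inv_add_inv_add_inv_add_inv_ne_zero (Ne.symm hx0) (Ne.symm hy0) (Ne.symm hz0)
    (Ne.symm hs0) hxy hxz hyz hs

theorem three_mul_ncard_vanishingFlats_swappedInv [Fintype K] {w : K} (hw : w ^ 2 + w + 1 = 0) :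
    3 * (vanishingFlats (swappedInv : K → K)).ncard = Fintype.card K - 1 := by
  have h0 := card_flatPairs (swappedInv : K → K) 0
  have h1 := card_flatPairs (swappedInv : K → K) 1
  have h01 := card_flatPairs_of_involutive (swappedInv_involutive (K := K)) 0
  rw [swappedInv_zero] at h01
  have hadd := Set.ncard_union_add_ncard_inter
    {S ∈ vanishingFlats (swappedInv : K → K) | (0 : K) ∈ S}
    {S ∈ vanishingFlats (swappedInv : K → K) | (1 : K) ∈ S}
  rw [sep_zero_union_sep_one_swappedInv, sep_zero_inter_sep_one_swappedInv hw,
    Set.ncard_singleton] at hadd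
  have hcard := card_flatPairs_swappedInv_zero hw
  omega

end CharTwo

/-! ### Reduction to `α = 1` and conclusion -/

theorem corollary3 {K : Type*} [Field K] [Fintype K] [DecidableEq K] (n : ℕ) (hn : Even n)
    (hK : Fintype.card K = 2 ^ n) (α : K) (hα : α ≠ 0) :
    (vanishingFlats (modifiedInverse n α)).ncard = (vanishingFlats (inverseFn K n)).ncard ∧
    ((vanishingFlats (inverseFn K n)).ncard : ℚ) = (1 / 3) * ((2 : ℚ) ^ n - 1) := by
  have : Fact (Nat.Prime 2) := ⟨Nat.prime_two⟩
  have : CharP K 2 := charP_of_card_eq_prime_pow hK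
  obtain ⟨w, hw⟩ := exists_primitive_cube_root hn hK
  have hF : inverseFn K n = fun x => x⁻¹ := funext (inverseFn_eq_inv hn hK)
  have hG : (vanishingFlats (modifiedInverse n α)).ncard =
      (vanishingFlats (swappedInv : K → K)).ncard := by
    -- The substitution `x ↦ α * x` moves the exceptional point `α` to 1 and multiplies values by
    -- `α⁻¹`.
    refine ncard_vanishingFlats_of_scaling hα (inv_ne_zero hα) fun x => ?_
    have hα' : α ^ (2 ^ n - 2) = α⁻¹ := inverseFn_eq_inv hn hK α
    rw [modifiedInverse, hF, hα']
    by_cases h0 : x = 0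
    · simp [h0, swappedInv_zero]
    by_cases h1 : x = 1
    · simp [h1, swappedInv_one]
    simp only [mul_inv]
    rw [swappedInv_of_ne h0 h1, Equiv.swap_apply_of_ne_of_ne]
    · simp [hα, h0]
    · simpa [hα] using h1
  have hinv := three_mul_ncard_vanishingFlats_inv hw
  have hswap := three_mul_ncard_vanishingFlats_swappedInv hw
  rw [hG, hF]
  refine ⟨by omega, ?_⟩
  have h1 : 3 * (vanishingFlats fun x : K => x⁻¹).ncard + 1 = 2 ^ n := by
    have := Fintype.card_pos (α := K)
    omega
  have h1' : (3 : ℚ) * ((vanishingFlats fun x : K => x⁻¹).ncard : ℚ) + 1 = 2 ^ n := by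
    exact_mod_cast h1
  linear_combination (1 / 3 : ℚ) * h1'
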